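/- Definitions (dimension $d=1$). A probability measure $P$ on $\mathbb R$ is *positive absolutely continuous* if $P\ll dx$ and $P(B)>0$ for every Borel set $B$ of positive Lebesgue measure. It is *$(C,\gamma)$-Frostman* if $P((x-r,x+r))\le C r^{\gamma}$ for all $x\in\mathbb R$, $r>0$. It has *properly $\epsilon$-disconnected support on $S_0,S_1$* if $S_0,S_1\subseteq\mathbb R$ are bounded open sets with disjoint closed convex hulls, $P(S_i)>0$ for $i=0,1$, $P(S_0)+P(S_1)\ge 1-\epsilon$, and $P(B)>0$ for every Borel set $B$ of positive Lebesgue measure that is contained in $S_0$ or in $S_1$. $\mathcal S(P_0,P_1)$ is the class of real-valued processes $X=(X_t)_{t\in[0,1]}$ (on any probability space) with almost surely continuous sample paths and $(X_0,X_1)\sim P_0\otimes P_1$. $\mathcal S_{\mathrm{SL}}(P_0,P_1)$ is the class of those $X\in\mathcal S(P_0,P_1)$ such that: - almost every path is locally absolutely continuous on $(0,1)$, with weak derivative $\dot X$, and $\int_a^b\mathbb E\big[|\dot X_t|\,\mathbf 1_{\{|X_t|\le R\}}\big]\,dt<\infty$ for all $R>0$ and $0<a<b<1$, so that the conditional velocity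 $\mathbb E[\dot X_t\mid X_t=x]$ is well-defined for almost every $t$ and $\mathrm{Law}(X_t)$-almost every $x$; - the conditional velocity has a version $v(t,x)$, defined on $[0,1]\times\mathbb R$, which is jointly measurable and satisfies, for some $L>0$, $|v(t,x)-v(t,y)|\le L|x-y|$ for all $t\in[0,1]$ and $x,y\in\mathbb R$; - the flow map $\phi$, given by $\partial_t\phi(t,x)=v(t,\phi(t,x))$ and $\phi(0,x)=x$ for $(t,x)\in[0,1]\times\mathbb R$, exists and satisfies $\partial_t^2\phi(t,x)=0$ for all $(t,x)\in[0,1]\times\mathbb R$. For $A,\alpha,\beta>0$, $\mathcal C(A,\alpha,\beta)$ is the class of real-valued processes with almost surely continuous sample paths on $[0,1]$ and $$\mathbb P\Big(\sup_{s,t\in[0,1],\,|t-s|\le\delta}|X_t-X_s|\ge\theta\Big)\le A\,\frac{\delta^{\alpha}}{\theta^{\beta}}\qquad\text{for all }\theta,\delta>0.$$ Theorem. For all $C,\gamma>0$, all $S_0,S_1\subseteq\mathbb R$, all $w_0,w_1>0$ and all $A,\alpha,\beta>0$ there is an $\epsilon_0>0$, depending only on $C,\gamma,S_0,S_1,w_0,w_1,A,\alpha,\beta$,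 such that the following holds. Let $P_0$ be a positive absolutely continuous, $(C,\gamma)$-Frostman probability measure on $\mathbb R$, and let $P_1$ be an absolutely continuous probability measure on $\mathbb R$ with properly $\epsilon$-disconnected support on $S_0,S_1$ for some $\epsilon>0$ and with $P_1(S_i)\ge w_i$ for $i=0,1$ (in particular, $P_1(S_i)=w_i$ is allowed). If $\epsilon\le\epsilon_0$, then $$\mathcal S_{\mathrm{SL}}(P_0,P_1)\cap\mathcal C(A,\alpha,\beta)=\emptyset .$$ -/

import Mathlib

open MeasureTheory ProbabilityTheory Set

universe u

/-! ### Measures on the real line -/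

/-- `P` is positive absolutely continuous: `P ≪ dx`, and `P` charges every Borel set of positive
Lebesgue measure. -/
def IsPositiveAC (P : Measure ℝ) : Prop :=
  P ≪ volume ∧ ∀ B : Set ℝ, MeasurableSet B → 0 < volume B → 0 < P B

/-- `P` is `(C, γ)`-Frostman: `P (B_r(x)) ≤ C r ^ γ` for all `x` and all `r > 0`. -/
def IsFrostman (P : Measure ℝ) (C γ : ℝ) : Prop :=
  ∀ x r : ℝ, 0 < r → P (Metric.ball x r) ≤ ENNReal.ofReal (C * r ^ γ)

/-- `P` has `ε`-disconnected support on the sets `S₀` and `S₁`. -/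
structure HasDisconnectedSupportOn (P : Measure ℝ) (ε : ℝ) (S₀ S₁ : Set ℝ) : Prop where
  isOpen₀ : IsOpen S₀
  isOpen₁ : IsOpen S₁
  isBounded₀ : Bornology.IsBounded S₀
  isBounded₁ : Bornology.IsBounded S₁
  hulls : closedConvexHull ℝ S₀ ∩ closedConvexHull ℝ S₁ = ∅
  pos₀ : 0 < P S₀
  pos₁ : 0 < P S₁
  mass : 1 - ε ≤ P.real S₀ + P.real S₁

/-- `P` has properly `ε`-disconnected support on the sets `S₀` and `S₁`. -/
structure HasProperlyDisconnectedSupportOn (P : Measure ℝ) (ε : ℝ) (S₀ S₁ : Set ℝ) : Prop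
    extends HasDisconnectedSupportOn P ε S₀ S₁ where
  proper₀ : ∀ B : Set ℝ, MeasurableSet B → B ⊆ S₀ → 0 < volume B → 0 < P B
  proper₁ : ∀ B : Set ℝ, MeasurableSet B → B ⊆ S₁ → 0 < volume B → 0 < P B

/-! ### Processes

A real process on the time interval `[0, 1]` is a map `X : ℝ → Ω → ℝ` of which only the values
`X t` with `t ∈ [0, 1]` are ever used. -/

section Processes

variable {Ω : Type u} [MeasurableSpace Ω]

/-- `X` is a stochastic process on `[0, 1]` with almost surely continuous sample paths. -/
structure IsContinuousProcess (μ : Measure Ω) (X : ℝ → Ω → ℝ) : Prop where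
  measurable : ∀ t ∈ Icc (0 : ℝ) 1, Measurable (X t)
  continuous : ∀ᵐ ω ∂μ, ContinuousOn (fun t => X t ω) (Icc 0 1)

/-- The class `𝒮(P₀, P₁)`: continuous processes with independent endpoints,
`(X₀, X₁) ∼ P₀ ⊗ P₁`. -/
def independentEndpointProcesses (μ : Measure Ω) (P₀ P₁ : Measure ℝ) : Set (ℝ → Ω → ℝ) :=
  {X | IsContinuousProcess μ X ∧ μ.map (fun ω => (X 0 ω, X 1 ω)) = P₀.prod P₁}

/-- `V` is the time derivative of the process `X`: almost every path of `X` is locally absolutely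
continuous (equivalently, of Sobolev class `W^{1,1}_loc`) in the open interval `(0, 1)`,
and its weak derivative is the path of `V`. This determines `V` up to `dt ⊗ μ`-null sets. -/
structure IsTimeDerivative (μ : Measure Ω) (X V : ℝ → Ω → ℝ) : Prop where
  measurable : Measurable (Function.uncurry V)
  integral_eq : ∀ᵐ ω ∂μ, ∀ s t : ℝ, 0 < s → s ≤ t → t < 1 →
    IntervalIntegrable (fun r => V r ω) volume s t ∧
      X t ω - X s ω = ∫ r in s..t, V r ω

/-- `v` is (a jointly measurable version of) the conditional velocity
`v(t, x) = 𝔼[V t | X t = x]`, where `V` is the time derivative of `X`. The conditional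
expectation is the mean of the conditional law of `V t` given `X t = x`, for almost every time `t`
and `Law(X t)`-almost every `x`. It is well-defined as a velocity field: the speed `|V|` has
finite expectation over bounded sets of positions and compact sets of times in `(0, 1)`. -/
structure IsConditionalVelocity (μ : Measure Ω) [IsFiniteMeasure μ] (X V : ℝ → Ω → ℝ)
    (v : ℝ → ℝ → ℝ) : Prop where
  measurable : Measurable (Function.uncurry v)
  locallyIntegrable : ∀ a b R : ℝ, 0 < a → b < 1 →
    ∫⁻ t in Icc a b, ∫⁻ ω in {ω | |X t ω| ≤ R}, ‖V t ω‖ₑ ∂μ < ⊤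
  eq_condMean : ∀ᵐ t ∂(volume.restrict (Icc (0 : ℝ) 1)), ∀ᵐ x ∂(μ.map (X t)),
    Integrable (fun y : ℝ => y) (condDistrib (V t) (X t) μ x) ∧
      v t x = ∫ y, y ∂(condDistrib (V t) (X t) μ x)

/-- `φ` is the flow map on `[0, 1]` of the velocity field `v` (one-sided time derivatives at the
endpoints). -/
def IsFlowMap (v φ : ℝ → ℝ → ℝ) : Prop :=
  ∀ x : ℝ, φ 0 x = x ∧
    ∀ t ∈ Icc (0 : ℝ) 1, HasDerivWithinAt (fun s => φ s x) (v t (φ t x)) (Icc 0 1) t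

/-- The second time derivative of `φ` exists and vanishes on `[0, 1] × ℝ`. -/
def HasNoAcceleration (φ : ℝ → ℝ → ℝ) : Prop :=
  ∀ x : ℝ, ∀ t ∈ Icc (0 : ℝ) 1,
    HasDerivWithinAt (fun s => derivWithin (fun r => φ r x) (Icc 0 1) s) 0 (Icc 0 1) t

/-- The class `𝒮_SL(P₀, P₁)` of straight-line processes connecting `P₀` and `P₁`. -/
def straightLineProcesses (μ : Measure Ω) [IsFiniteMeasure μ] (P₀ P₁ : Measure ℝ) :
    Set (ℝ → Ω → ℝ) :=
  {X | X ∈ independentEndpointProcesses μ P₀ P₁ ∧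
    ∃ (V : ℝ → Ω → ℝ) (v φ : ℝ → ℝ → ℝ),
      IsTimeDerivative μ X V ∧ IsConditionalVelocity μ X V v ∧
      (∃ L : ℝ, 0 < L ∧ ∀ t ∈ Icc (0 : ℝ) 1, ∀ x y : ℝ, |v t x - v t y| ≤ L * |x - y|) ∧
      IsFlowMap v φ ∧ HasNoAcceleration φ}

/-- The modulus of continuity on `[0, 1]` of the path of `X` at `ω`, with values in `[0, ∞]`. -/
noncomputable def pathModulus (X : ℝ → Ω → ℝ) (δ : ℝ) (ω : Ω) : ENNReal :=
  ⨆ (t ∈ Icc (0 : ℝ) 1) (s ∈ Icc (0 : ℝ) 1) (_ : |t - s| ≤ δ), ENNReal.ofReal |X t ω - X s ω|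

/-- The class `𝒞(A, α, β)`: continuous processes with
`μ(κ_X(δ) ≥ θ) ≤ A δ ^ α / θ ^ β` for all `θ, δ > 0`. -/
def concentrationClass (μ : Measure Ω) (A α β : ℝ) : Set (ℝ → Ω → ℝ) :=
  {X | IsContinuousProcess μ X ∧ ∀ θ δ : ℝ, 0 < θ → 0 < δ →
    μ {ω | ENNReal.ofReal θ ≤ pathModulus X δ ω} ≤ ENNReal.ofReal (A * (δ ^ α / θ ^ β))}

end Processes

open Filter Topology

/-! Without acceleration the flow lines are straight lines `x + t * u x`, and the Lipschitz
conditional velocity transports the marginal laws, so the mass to the left of each line is constant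
in time (`measureReal_lt_characteristic_eq`). Hence `x + u x` maps quantiles of `P₀` to quantiles of
`P₁`. It is continuous, so some line from `a` ends at the left edge `l` of the gap between `S₀` and
`S₁`, and some line from `b` ends at the right edge `r`. At every time, the strip between these
lines carries only the mass of `P₁` in the gap, at most `ε`.

Independence of the endpoints forces many paths across this strip: a fixed amount of mass starts
well to the left of `a` (by the Frostman bound) and, independently, a fixed amount ends to the right
of `r`. The strip has width at least `τ * (r - l)` after time `τ`, and paths starting far from `a`
seldom reach it earlier. On a fine enough time grid, a path with controlled modulus cannot jump over
it, so it is inside at one of the `N + 1` grid times (`exists_grid_mem_strip`). The crossing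
probability is thus at most `(N + 1) * ε` plus two small modulus terms, which is too little for
small `ε`. Tightness of `P₀` bounds `a`, hence the slope of the left line, which makes all constants
uniform. -/

/-! ### Chain rule along paths, conditional means, measurable modifications -/

theorem AbsolutelyContinuousOnInterval.comp_lipschitzWith {f : ℝ → ℝ} {h : ℝ → ℝ} {K : NNReal}
    {a b : ℝ} (hf : AbsolutelyContinuousOnInterval f a b) (hh : LipschitzWith K h) :
    AbsolutelyContinuousOnInterval (fun x => h (f x)) a b := by
  have hK := Filter.Tendsto.const_mul (K : ℝ) hf
  rw [mul_zero] at hK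
  refine squeeze_zero (fun E => Finset.sum_nonneg fun i _ => dist_nonneg) (fun E => ?_) hK
  rw [Finset.mul_sum]
  exact Finset.sum_le_sum fun i _ => hh.dist_le_mul _ _

/-- Chain rule in integral form for the composition of a Lipschitz `C¹` function with an
indefinite integral. -/
theorem comp_sub_comp_eq_integral_deriv_mul {h Y U : ℝ → ℝ} {K : NNReal} {s t : ℝ} (hst : s ≤ t)
    (hh : Differentiable ℝ h) (hK : LipschitzWith K h)
    (hU : IntervalIntegrable U volume s t)
    (hY : ∀ r ∈ Icc s t, Y r - Y s = ∫ x in s..r, U x) :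
    h (Y t) - h (Y s) = ∫ r in s..t, deriv h (Y r) * U r := by
  set Z : ℝ → ℝ := fun r => Y s + ∫ x in s..r, U x with hZ
  have hYZ : ∀ r ∈ Icc s t, Y r = Z r := fun r hr => by
    simp only [hZ]; linarith [hY r hr]
  have hac : AbsolutelyContinuousOnInterval Z s t := by
    have hc : AbsolutelyContinuousOnInterval (fun _ : ℝ => Y s) s t :=
      (LipschitzWith.const (Y s)).lipschitzOnWith.absolutelyContinuousOnInterval
    exact hc.fun_add (hU.absolutelyContinuousOnInterval_intervalIntegral (by simp))
  rw [hYZ t ⟨hst, le_rfl⟩, hYZ s ⟨le_rfl, hst⟩, ← (hac.comp_lipschitzWith hK).integral_deriv_eq_sub]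
  refine intervalIntegral.integral_congr_ae ?_
  filter_upwards [hU.ae_hasDerivAt_integral] with x hx hxs
  have hx' : x ∈ uIcc s t := uIoc_subset_uIcc hxs
  have h1 : HasDerivAt Z (U x) x := (hx hx' s (by simp)).const_add (Y s)
  rw [hYZ x (by rwa [uIcc_of_le hst] at hx')]
  exact ((hh (Z x)).hasDerivAt.comp x h1).deriv

/-- Testing against functions of `X` replaces `V` by its conditional mean given `X`. -/
theorem integral_mul_eq_integral_mul_condMean {Ω : Type u} [MeasurableSpace Ω] {μ : Measure Ω}
    [IsFiniteMeasure μ] {X V : Ω → ℝ} {w g : ℝ → ℝ} (hX : Measurable X) (hV : Measurable V)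
    (hw : Measurable w) (hg : Measurable g)
    (hcond : ∀ᵐ x ∂(μ.map X), w x = ∫ y, y ∂(condDistrib V X μ x))
    (hint : Integrable (fun ω => g (X ω) * V ω) μ) :
    ∫ ω, g (X ω) * V ω ∂μ = ∫ ω, g (X ω) * w (X ω) ∂μ := by
  have hmeas : Measurable fun z : ℝ × ℝ => g z.1 * z.2 := by fun_prop
  have hpair : Measurable fun ω => (X ω, V ω) := hX.prodMk hV
  have h1 : Integrable (fun z : ℝ × ℝ => g z.1 * z.2) (μ.map fun ω => (X ω, V ω)) :=
    (integrable_map_measure hmeas.aestronglyMeasurable hpair.aemeasurable).2 hint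
  have h2 := h1
  rw [← compProd_map_condDistrib hV.aemeasurable] at h2
  calc ∫ ω, g (X ω) * V ω ∂μ
      = ∫ z, g z.1 * z.2 ∂(μ.map fun ω => (X ω, V ω)) :=
        (integral_map hpair.aemeasurable hmeas.aestronglyMeasurable).symm
    _ = ∫ x, ∫ y, g x * y ∂(condDistrib V X μ x) ∂(μ.map X) := by
        rw [← compProd_map_condDistrib hV.aemeasurable, Measure.integral_compProd h2]
    _ = ∫ x, g x * w x ∂(μ.map X) := by
        refine integral_congr_ae ?_
        filter_upwards [hcond] with x hx
        rw [integral_const_mul, hx]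
    _ = ∫ ω, g (X ω) * w (X ω) ∂μ :=
        integral_map hX.aemeasurable (by fun_prop)

/-- A continuous process has a jointly measurable modification. -/
theorem IsContinuousProcess.exists_measurable_modification {Ω : Type u} [MeasurableSpace Ω]
    {μ : Measure Ω} {X : ℝ → Ω → ℝ} (hX : IsContinuousProcess μ X) :
    ∃ Z : ℝ → Ω → ℝ, Measurable (Function.uncurry Z) ∧
      ∀ᵐ ω ∂μ, ∀ t ∈ Icc (0 : ℝ) 1, Z t ω = X t ω := by
  obtain ⟨N, hN, hNm, hN0⟩ := exists_measurable_superset_of_null (ae_iff.1 hX.continuous)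
  classical
  -- Clamping time and erasing the exceptional paths makes every path continuous on the whole line;
  -- with measurability at each time this gives joint measurability.
  refine ⟨fun t ω => if ω ∈ N then 0 else X (projIcc 0 1 zero_le_one t) ω, ?_, ?_⟩
  · refine measurable_uncurry_of_continuous_of_measurable (fun ω => ?_) fun t => ?_
    · by_cases hω : ω ∈ N
      · simp only [hω, if_true]; exact continuous_const
      · simp only [hω, if_false]
        have hc : ContinuousOn (fun t => X t ω) (Icc 0 1) := by
          by_contra hc
          exact hω (hN hc)
        exact hc.comp_continuous (continuous_subtype_val.comp continuous_projIcc)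
          fun t => (projIcc 0 1 zero_le_one t).2
    · exact Measurable.ite hNm measurable_const (hX.measurable _ (projIcc 0 1 zero_le_one t).2)
  · filter_upwards [measure_eq_zero_iff_ae_notMem.1 hN0] with ω hω t ht
    simp only [hω, if_false, projIcc_of_mem zero_le_one ht]

/-! ### The continuity equation tested along a straight characteristic -/

section Transport

variable {Ω : Type u} [MeasurableSpace Ω] {μ : Measure Ω} [IsProbabilityMeasure μ]
  {X V : ℝ → Ω → ℝ} {v : ℝ → ℝ → ℝ}

/-- The product of the velocity with a bounded observable of compact support in the position
is integrable in time and chance. -/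
theorem IsConditionalVelocity.integrable_mul (hXm : Measurable (Function.uncurry X))
    (hV : IsTimeDerivative μ X V) (hv : IsConditionalVelocity μ X V v)
    {s t : ℝ} (hs : 0 < s) (ht : t < 1) {G : ℝ × Ω → ℝ} (hG : Measurable G) {c R : ℝ}
    (hc : ∀ z, |G z| ≤ c) (hR : ∀ z : ℝ × Ω, z.1 ∈ Ioc s t → G z ≠ 0 → |X z.1 z.2| ≤ R) :
    Integrable (fun z : ℝ × Ω => G z * V z.1 z.2) ((volume.restrict (Ioc s t)).prod μ) := by
  have hVm : Measurable fun z : ℝ × Ω => V z.1 z.2 := hV.measurable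
  have hm : Measurable fun z : ℝ × Ω => G z * V z.1 z.2 := hG.mul hVm
  refine ⟨hm.aestronglyMeasurable, ?_⟩
  rw [hasFiniteIntegral_iff_enorm, lintegral_prod _ hm.enorm.aemeasurable]
  calc ∫⁻ r in Ioc s t, ∫⁻ ω, ‖G (r, ω) * V r ω‖ₑ ∂μ
      ≤ ∫⁻ r in Ioc s t, ENNReal.ofReal c * ∫⁻ ω in {ω | |X r ω| ≤ R}, ‖V r ω‖ₑ ∂μ := by
        refine setLIntegral_mono' measurableSet_Ioc fun r hr => ?_
        have hXr : Measurable (X r) := hXm.comp measurable_prodMk_left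
        have hVr : Measurable (V r) := hV.measurable.comp measurable_prodMk_left
        have hset : MeasurableSet {ω | |X r ω| ≤ R} :=
          measurableSet_le (by fun_prop) measurable_const
        rw [← lintegral_indicator hset, ← lintegral_const_mul _ (hVr.enorm.indicator hset)]
        refine lintegral_mono fun ω => ?_
        by_cases hG0 : G (r, ω) = 0
        · simp [hG0]
        · rw [indicator_of_mem (show ω ∈ {ω | |X r ω| ≤ R} from hR (r, ω) hr hG0), enorm_mul]
          gcongr
          rw [← ofReal_norm]
          exact ENNReal.ofReal_le_ofReal (hc _)
    _ ≤ ∫⁻ r in Icc s t, ENNReal.ofReal c * ∫⁻ ω in {ω | |X r ω| ≤ R}, ‖V r ω‖ₑ ∂μ :=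
        lintegral_mono_set Ioc_subset_Icc_self
    _ = ENNReal.ofReal c * ∫⁻ r in Icc s t, ∫⁻ ω in {ω | |X r ω| ≤ R}, ‖V r ω‖ₑ ∂μ :=
        lintegral_const_mul' _ _ ENNReal.ofReal_ne_top
    _ < ⊤ := ENNReal.mul_lt_top ENNReal.ofReal_lt_top (hv.locallyIntegrable s t R hs ht)

/-- Along a straight characteristic `a + t m` of the conditional velocity, the expectation of an
observable of the relative position changes only through the spatial variation of the
velocity. -/
theorem abs_integral_comp_sub_le (hXm : Measurable (Function.uncurry X))
    (hV : IsTimeDerivative μ X V) (hv : IsConditionalVelocity μ X V v) {L a m : ℝ}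
    (hL : ∀ t ∈ Icc (0 : ℝ) 1, ∀ x y : ℝ, |v t x - v t y| ≤ L * |x - y|)
    (hm : ∀ t ∈ Icc (0 : ℝ) 1, v t (a + t * m) = m)
    {h : ℝ → ℝ} (hh : ContDiff ℝ 1 h) {B R c : ℝ} (hB : ∀ x, |h x| ≤ B)
    (hR : ∀ x, deriv h x ≠ 0 → |x| ≤ R) (hc : ∀ x, |deriv h x| ≤ c)
    {s t : ℝ} (hs : 0 < s) (hst : s ≤ t) (ht : t < 1) :
    |∫ ω, h (X t ω - (a + t * m)) ∂μ - ∫ ω, h (X s ω - (a + s * m)) ∂μ| ≤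
      L * ∫ z : ℝ × Ω, |deriv h (X z.1 z.2 - (a + z.1 * m)) * (X z.1 z.2 - (a + z.1 * m))|
        ∂((volume.restrict (Ioc s t)).prod μ) := by
  set Y : ℝ → Ω → ℝ := fun r ω => X r ω - (a + r * m) with hY
  have hYm : Measurable (Function.uncurry Y) := by
    have : Measurable fun z : ℝ × Ω => X z.1 z.2 - (a + z.1 * m) := by
      have : Measurable fun z : ℝ × Ω => X z.1 z.2 := hXm
      fun_prop
    exact this
  have hYm' : Measurable fun z : ℝ × Ω => Y z.1 z.2 := hYm
  have hXr : ∀ r, Measurable (X r) := fun r => hXm.comp measurable_prodMk_left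
  have hVr : ∀ r, Measurable (V r) := fun r => hV.measurable.comp measurable_prodMk_left
  have hvr : ∀ r, Measurable (v r) := fun r => hv.measurable.comp measurable_prodMk_left
  have hYr : ∀ r, Measurable (Y r) := fun r => hYm.comp measurable_prodMk_left
  have hh' : Measurable (deriv h) := (hh.continuous_deriv le_rfl).measurable
  have hhm : Measurable h := hh.continuous.measurable
  have hc0 : 0 ≤ c := (abs_nonneg _).trans (hc 0)
  have hLip : LipschitzWith ⟨c, hc0⟩ h :=
    lipschitzWith_of_nnnorm_deriv_le (hh.differentiable one_ne_zero) fun x => hc x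
  have hinth : ∀ r, Integrable (fun ω => h (Y r ω)) μ := fun r =>
    Integrable.of_bound (by fun_prop) B (Eventually.of_forall fun ω => hB _)
  -- The velocity is only integrable over bounded positions; the compact support of `deriv h`
  -- supplies the bound.
  have hpos : ∀ z : ℝ × Ω, z.1 ∈ Ioc s t → deriv h (Y z.1 z.2) ≠ 0 →
      |X z.1 z.2| ≤ R + (|a| + |m|) := by
    intro z hz hne
    have h1 := hR _ hne
    have h2 : |z.1 * m| ≤ |m| := by
      rw [abs_mul, abs_of_pos (hs.trans hz.1)]
      exact mul_le_of_le_one_left (abs_nonneg _) (hz.2.trans ht.le)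
    have h3 : X z.1 z.2 = Y z.1 z.2 + (a + z.1 * m) := by simp [hY]
    rw [h3]
    exact (abs_add_le _ _).trans (add_le_add h1 ((abs_add_le _ _).trans (by gcongr)))
  have hI1 : Integrable (fun z : ℝ × Ω => deriv h (Y z.1 z.2) * V z.1 z.2)
      ((volume.restrict (Ioc s t)).prod μ) :=
    hv.integrable_mul hXm hV hs ht (hh'.comp hYm') (fun z => hc _) hpos
  have hI2 : Integrable (fun z : ℝ × Ω => deriv h (Y z.1 z.2) * m)
      ((volume.restrict (Ioc s t)).prod μ) :=
    Integrable.of_bound (by fun_prop) (c * |m|) (Eventually.of_forall fun z => by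
      rw [Real.norm_eq_abs, abs_mul]
      exact mul_le_mul_of_nonneg_right (hc _) (abs_nonneg _))
  have hI : Integrable (fun z : ℝ × Ω => deriv h (Y z.1 z.2) * (V z.1 z.2 - m))
      ((volume.restrict (Ioc s t)).prod μ) := by
    simpa only [mul_sub] using hI1.sub' hI2
  have hYint : ∀ z : ℝ × Ω, |deriv h (Y z.1 z.2) * Y z.1 z.2| ≤ c * |R| := by
    intro z
    by_cases h0 : deriv h (Y z.1 z.2) = 0
    · simpa [h0] using mul_nonneg hc0 (abs_nonneg R)
    · rw [abs_mul]
      exact mul_le_mul (hc _) ((hR _ h0).trans (le_abs_self R)) (abs_nonneg _) hc0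
  have hJ : Integrable (fun z : ℝ × Ω => |deriv h (Y z.1 z.2) * Y z.1 z.2|)
      ((volume.restrict (Ioc s t)).prod μ) :=
    Integrable.of_bound (by fun_prop) (c * |R|) (Eventually.of_forall fun z => by
      rw [Real.norm_eq_abs, abs_abs]; exact hYint z)
  have hpath : ∀ᵐ ω ∂μ, h (Y t ω) - h (Y s ω) =
      ∫ r in Ioc s t, deriv h (Y r ω) * (V r ω - m) := by
    filter_upwards [hV.integral_eq] with ω hω
    rw [← intervalIntegral.integral_of_le hst]
    refine comp_sub_comp_eq_integral_deriv_mul (Y := fun r => Y r ω) hst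
      (hh.differentiable one_ne_zero) hLip
      ((hω s t hs hst ht).1.sub (intervalIntegrable_const (c := m))) fun r hr => ?_
    have h1 := hω s r hs hr.1 (hr.2.trans_lt ht)
    rw [intervalIntegral.integral_sub h1.1 intervalIntegrable_const, ← h1.2]
    simp [hY]
    ring
  have hmean : ∀ᵐ r ∂(volume.restrict (Ioc s t)),
      ∫ ω, deriv h (Y r ω) * (V r ω - m) ∂μ =
        ∫ ω, deriv h (Y r ω) * (v r (X r ω) - m) ∂μ ∧
      Integrable (fun ω => |deriv h (Y r ω) * Y r ω|) μ := by
    have hsub : Ioc s t ⊆ Icc (0 : ℝ) 1 := fun r hr => ⟨(hs.trans hr.1).le, hr.2.trans ht.le⟩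
    filter_upwards [ae_restrict_of_ae_restrict_of_subset hsub hv.eq_condMean, hI.prod_right_ae,
      hJ.prod_right_ae] with r hr1 hr2 hr3
    refine ⟨?_, hr3⟩
    refine integral_mul_eq_integral_mul_condMean (X := X r) (V := fun ω => V r ω - m)
      (w := fun x => v r x - m) (g := fun x => deriv h (x - (a + r * m))) (hXr r)
      ((hVr r).sub_const m) ((hvr r).sub_const m) (by fun_prop) ?_ hr2
    -- The conditional law of `V r - m` is a translate of that of `V r`, so its mean is `v r x - m`.
    have hcd := condDistrib_comp (mβ := Real.measurableSpace) (μ := μ) (X r) (hVr r).aemeasurable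
      (f := fun y : ℝ => y - m) (by fun_prop)
    filter_upwards [hr1, hcd] with x hx1 hx2
    have hx2' : condDistrib (fun ω => V r ω - m) (X r) μ x =
      (condDistrib (V r) (X r) μ x).map (fun y => y - m) := by
      rw [← Kernel.map_apply _ (by fun_prop)]; exact hx2
    rw [hx2', integral_map (by fun_prop) (by fun_prop), integral_sub hx1.1 (integrable_const _),
      ← hx1.2]
    simp
  calc |∫ ω, h (Y t ω) ∂μ - ∫ ω, h (Y s ω) ∂μ|
      = |∫ ω, (∫ r in Ioc s t, deriv h (Y r ω) * (V r ω - m)) ∂μ| := by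
        rw [← integral_sub (hinth t) (hinth s)]
        congr 1
        exact integral_congr_ae hpath
    _ = |∫ r in Ioc s t, (∫ ω, deriv h (Y r ω) * (V r ω - m) ∂μ)| := by
        congr 1
        exact (integral_integral_swap hI).symm
    _ ≤ ∫ r in Ioc s t, (L * ∫ ω, |deriv h (Y r ω) * Y r ω| ∂μ) := by
        rw [← Real.norm_eq_abs]
        refine norm_integral_le_of_norm_le (hJ.integral_prod_left.const_mul L) ?_
        filter_upwards [hmean, ae_restrict_mem measurableSet_Ioc] with r hr hrI
        rw [hr.1, ← integral_const_mul]
        refine norm_integral_le_of_norm_le (hr.2.const_mul L) (Eventually.of_forall fun ω => ?_)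
        have hrI' : r ∈ Icc (0 : ℝ) 1 := ⟨(hs.trans hrI.1).le, hrI.2.trans ht.le⟩
        -- The line is itself a characteristic, so `v - m` is a difference of velocities at two
        -- positions and is at most `L * |Y|`.
        have h1 := hL r hrI' (X r ω) (a + r * m)
        rw [hm r hrI'] at h1
        rw [Real.norm_eq_abs, abs_mul, abs_mul]
        calc _ ≤ |deriv h (Y r ω)| * (L * |Y r ω|) := by gcongr
          _ = _ := by ring
    _ = L * ∫ z : ℝ × Ω, |deriv h (Y z.1 z.2) * Y z.1 z.2|
        ∂((volume.restrict (Ioc s t)).prod μ) := by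
        rw [integral_const_mul, integral_prod _ hJ]

end Transport

/-! ### Conservation of mass to the left of a straight line -/

theorem Real.smoothTransition.abs_le_one_of_deriv_ne_zero {x : ℝ}
    (hx : deriv Real.smoothTransition x ≠ 0) : |x| ≤ 1 := by
  rcases lt_or_ge x 0 with h | h
  · refine absurd ?_ hx
    have : Real.smoothTransition =ᶠ[𝓝 x] fun _ => (0 : ℝ) := by
      filter_upwards [Iio_mem_nhds h] with y hy
      exact Real.smoothTransition.zero_of_nonpos (le_of_lt hy)
    rw [this.deriv_eq, deriv_const]
  · rw [abs_of_nonneg h]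
    by_contra! h1
    refine hx ?_
    have : Real.smoothTransition =ᶠ[𝓝 x] fun _ => (1 : ℝ) := by
      filter_upwards [Ioi_mem_nhds h1] with y hy
      exact Real.smoothTransition.one_of_one_le (le_of_lt hy)
    rw [this.deriv_eq, deriv_const]

theorem Real.smoothTransition.exists_abs_deriv_le :
    ∃ c : ℝ, 0 ≤ c ∧ ∀ x, |deriv Real.smoothTransition x| ≤ c := by
  have hcont : Continuous (deriv Real.smoothTransition) :=
    (Real.smoothTransition.contDiff (n := 1)).continuous_deriv le_rfl
  obtain ⟨c, hc⟩ := (isCompact_Icc (a := (-1 : ℝ)) (b := 1)).exists_bound_of_continuousOn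
    hcont.continuousOn
  have hc0 : 0 ≤ c := (norm_nonneg _).trans (hc 0 (by simp))
  refine ⟨c, hc0, fun x => ?_⟩
  by_cases hx : deriv Real.smoothTransition x = 0
  · simpa [hx] using hc0
  · exact hc x (abs_le.1 (Real.smoothTransition.abs_le_one_of_deriv_ne_zero hx))

section Transport

variable {Ω : Type u} [MeasurableSpace Ω] {μ : Measure Ω} [IsProbabilityMeasure μ]
  {X V : ℝ → Ω → ℝ} {v : ℝ → ℝ → ℝ}

/-- Smooth steps of width `1 / n` replace the indicator of the left side. The transport error is `L`
times the integral of `|h' y * y|`, which is bounded uniformly in `n` by scale invariance and tends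
to zero pointwise, so dominated convergence removes it. -/
theorem measureReal_lt_characteristic_eq_of_measurable (hXm : Measurable (Function.uncurry X))
    (hV : IsTimeDerivative μ X V) (hv : IsConditionalVelocity μ X V v) {L a m : ℝ}
    (hL : ∀ t ∈ Icc (0 : ℝ) 1, ∀ x y : ℝ, |v t x - v t y| ≤ L * |x - y|)
    (hm : ∀ t ∈ Icc (0 : ℝ) 1, v t (a + t * m) = m)
    {s t : ℝ} (hs : 0 < s) (hst : s ≤ t) (ht : t < 1) :
    μ.real {ω | X t ω < a + t * m} = μ.real {ω | X s ω < a + s * m} := by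
  obtain ⟨c, hc0, hc⟩ := Real.smoothTransition.exists_abs_deriv_le
  set S := Real.smoothTransition with hS
  have hXr : ∀ r, Measurable (X r) := fun r => hXm.comp measurable_prodMk_left
  have hXm' : Measurable fun z : ℝ × Ω => X z.1 z.2 := hXm
  have hScont : Continuous S := Real.smoothTransition.continuous
  have hS' : Measurable (deriv S) := measurable_deriv S
  -- The step vanishes for all `y ≥ 0`, so the limit is the indicator of the strict inequality even
  -- on the line itself.
  set h : ℕ → ℝ → ℝ := fun n y => S (-(n : ℝ) * y) with hh
  have hhC : ∀ n, ContDiff ℝ 1 (h n) := fun n =>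
    Real.smoothTransition.contDiff.comp (contDiff_const.mul contDiff_id)
  have hderiv : ∀ n y, deriv (h n) y = -(n : ℝ) * deriv S (-(n : ℝ) * y) := fun n y => by
    exact deriv_comp_mul_left (-(n : ℝ)) S y
  have habs : ∀ x, |S x| ≤ 1 := fun x =>
    abs_le.2 ⟨by linarith [Real.smoothTransition.nonneg x], Real.smoothTransition.le_one x⟩
  have hlim1 : ∀ r, Tendsto (fun n => ∫ ω, h n (X r ω - (a + r * m)) ∂μ) atTop
      (𝓝 (μ.real {ω | X r ω < a + r * m})) := by
    intro r
    have hset : MeasurableSet {ω | X r ω < a + r * m} :=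
      measurableSet_lt (hXr r) measurable_const
    rw [← integral_indicator_one hset]
    refine tendsto_integral_of_dominated_convergence (fun _ => 1)
      (fun n => ?_) (integrable_const 1)
      (fun n => Eventually.of_forall fun ω => habs _) (Eventually.of_forall fun ω => ?_)
    · exact (hScont.measurable.comp (((hXr r).sub_const _).const_mul _)).aestronglyMeasurable
    · by_cases hω : X r ω < a + r * m
      · rw [indicator_of_mem (show ω ∈ {ω | X r ω < a + r * m} from hω)]
        have h1 : Tendsto (fun n : ℕ => (n : ℝ) * (a + r * m - X r ω)) atTop atTop :=
          tendsto_natCast_atTop_atTop.atTop_mul_const (sub_pos.2 hω)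
        refine tendsto_const_nhds.congr' ?_
        filter_upwards [h1.eventually_ge_atTop 1] with n hn
        exact (Real.smoothTransition.one_of_one_le (by linarith)).symm
      · rw [indicator_of_notMem (show ω ∉ {ω | X r ω < a + r * m} from hω)]
        refine tendsto_const_nhds.congr fun n => ?_
        refine (Real.smoothTransition.zero_of_nonpos ?_).symm
        have := mul_nonneg n.cast_nonneg (sub_nonneg.2 (not_lt.1 hω))
        linarith
  have hkey : ∀ (n : ℕ) (y : ℝ), |deriv (h n) y * y| = |deriv S (-(n : ℝ) * y) * (-(n : ℝ) * y)| :=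
    fun n y => by rw [hderiv]; congr 1; ring
  have hbound : ∀ z : ℝ, |deriv S z * z| ≤ c := by
    intro z
    by_cases hz : deriv S z = 0
    · simpa [hz] using hc0
    · rw [abs_mul]
      exact (mul_le_mul (hc z) (Real.smoothTransition.abs_le_one_of_deriv_ne_zero hz)
        (abs_nonneg _) hc0).trans_eq (mul_one c)
  have hlim2 : Tendsto (fun n => ∫ z : ℝ × Ω, |deriv (h n) (X z.1 z.2 - (a + z.1 * m)) *
      (X z.1 z.2 - (a + z.1 * m))| ∂((volume.restrict (Ioc s t)).prod μ)) atTop (𝓝 0) := by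
    rw [← integral_zero (ℝ × Ω) ℝ (μ := (volume.restrict (Ioc s t)).prod μ)]
    refine tendsto_integral_of_dominated_convergence (fun _ => c)
      (fun n => ?_) (integrable_const c)
      (fun n => Eventually.of_forall fun z => ?_) (Eventually.of_forall fun z => ?_)
    · have := measurable_deriv (h n)
      exact Measurable.aestronglyMeasurable (by fun_prop)
    · rw [Real.norm_eq_abs, abs_abs, hkey]
      exact hbound _
    · set y := X z.1 z.2 - (a + z.1 * m)
      by_cases hy : y = 0
      · simp [hy]
      · have h1 : Tendsto (fun n : ℕ => (n : ℝ) * |y|) atTop atTop :=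
          tendsto_natCast_atTop_atTop.atTop_mul_const (abs_pos.2 hy)
        refine tendsto_const_nhds.congr' ?_
        filter_upwards [h1.eventually_gt_atTop 1] with n hn
        rw [hkey]
        have h0 : deriv S (-(n : ℝ) * y) = 0 := by
          by_contra hne
          have h2 := Real.smoothTransition.abs_le_one_of_deriv_ne_zero hne
          rw [abs_mul, abs_neg, Nat.abs_cast] at h2
          linarith
        rw [h0, zero_mul, abs_zero]
  have hle : ∀ n : ℕ, |∫ ω, h n (X t ω - (a + t * m)) ∂μ - ∫ ω, h n (X s ω - (a + s * m)) ∂μ| ≤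
      L * ∫ z : ℝ × Ω, |deriv (h n) (X z.1 z.2 - (a + z.1 * m)) *
        (X z.1 z.2 - (a + z.1 * m))| ∂((volume.restrict (Ioc s t)).prod μ) := by
    intro n
    refine abs_integral_comp_sub_le hXm hV hv hL hm (hhC n) (B := 1) (R := 1)
      (c := n * c) (fun x => habs _) (fun x hx => ?_) (fun x => ?_) hs hst ht
    · rw [hderiv] at hx
      have h1 := Real.smoothTransition.abs_le_one_of_deriv_ne_zero (right_ne_zero_of_mul hx)
      -- For `n = 0` the step is constant; for `n ≥ 1` its derivative lives in `|y| ≤ 1 / n ≤ 1`.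
      have hn : (1 : ℝ) ≤ n := by
        rcases Nat.eq_zero_or_pos n with h0 | h0
        · simp [h0] at hx
        · exact_mod_cast h0
      rw [abs_mul, abs_neg, Nat.abs_cast] at h1
      nlinarith [abs_nonneg x]
    · rw [hderiv, abs_mul, abs_neg, Nat.abs_cast]
      exact mul_le_mul_of_nonneg_left (hc _) n.cast_nonneg
  have hfin := le_of_tendsto_of_tendsto' ((hlim1 t).sub (hlim1 s)).abs (hlim2.const_mul L) hle
  rw [mul_zero] at hfin
  exact sub_eq_zero.1 (abs_eq_zero.1 (le_antisymm hfin (abs_nonneg _)))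

/-- Each hypothesis depends on `X` only up to null sets at fixed times, or along almost every path,
so it passes to a jointly measurable modification. -/
theorem measureReal_lt_characteristic_eq_of_pos (hX : IsContinuousProcess μ X)
    (hV : IsTimeDerivative μ X V) (hv : IsConditionalVelocity μ X V v) {L a m : ℝ}
    (hL : ∀ t ∈ Icc (0 : ℝ) 1, ∀ x y : ℝ, |v t x - v t y| ≤ L * |x - y|)
    (hm : ∀ t ∈ Icc (0 : ℝ) 1, v t (a + t * m) = m)
    {s t : ℝ} (hs : 0 < s) (hst : s ≤ t) (ht : t < 1) :
    μ.real {ω | X t ω < a + t * m} = μ.real {ω | X s ω < a + s * m} := by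
  obtain ⟨Z, hZm, hZ⟩ := hX.exists_measurable_modification
  have hZt : ∀ t ∈ Icc (0 : ℝ) 1, Z t =ᵐ[μ] X t := fun t ht => by
    filter_upwards [hZ] with ω hω using hω t ht
  have hset : ∀ t ∈ Icc (0 : ℝ) 1, μ.real {ω | X t ω < a + t * m} =
      μ.real {ω | Z t ω < a + t * m} := fun t ht => by
    refine measureReal_congr (eventuallyEq_set.2 ?_)
    filter_upwards [hZt t ht] with ω hω
    simp only [hω]
  rw [hset t ⟨(hs.trans_le hst).le, ht.le⟩, hset s ⟨hs.le, hst.trans ht.le⟩]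
  refine measureReal_lt_characteristic_eq_of_measurable hZm ⟨hV.measurable, ?_⟩
    ⟨hv.measurable, fun p q R hp hq => ?_, ?_⟩ hL hm hs hst ht
  · filter_upwards [hV.integral_eq, hZ] with ω h1 h2 p q hp hpq hq
    rw [h2 p ⟨hp.le, hpq.trans hq.le⟩, h2 q ⟨(hp.trans_le hpq).le, hq.le⟩]
    exact h1 p q hp hpq hq
  · refine lt_of_eq_of_lt ?_ (hv.locallyIntegrable p q R hp hq)
    refine setLIntegral_congr_fun measurableSet_Icc fun r hr => ?_
    refine setLIntegral_congr (eventuallyEq_set.2 ?_)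
    filter_upwards [hZt r ⟨hp.le.trans hr.1, hr.2.trans hq.le⟩] with ω hω
    simp only [hω]
  · filter_upwards [hv.eq_condMean, ae_restrict_mem measurableSet_Icc] with r hr hrI
    rw [Measure.map_congr (hZt r hrI), condDistrib_congr (ae_eq_refl (V r)) (hZt r hrI)]
    exact hr

end Transport

section Transport

variable {Ω : Type u} [MeasurableSpace Ω] {μ : Measure Ω} [IsProbabilityMeasure μ]
  {X V : ℝ → Ω → ℝ} {v : ℝ → ℝ → ℝ}

/-- The mass to the left of a line is continuous along times at whose limit the line carries no
mass. -/
theorem IsContinuousProcess.tendsto_measureReal_lt (hX : IsContinuousProcess μ X) {a m t : ℝ}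
    (ht : t ∈ Icc (0 : ℝ) 1) (h0 : μ {ω | X t ω = a + t * m} = 0) {u : ℕ → ℝ}
    (hu : ∀ n, u n ∈ Icc (0 : ℝ) 1) (hut : Tendsto u atTop (𝓝 t)) :
    Tendsto (fun n => μ.real {ω | X (u n) ω < a + u n * m}) atTop
      (𝓝 (μ.real {ω | X t ω < a + t * m})) := by
  have hms : ∀ r ∈ Icc (0 : ℝ) 1, MeasurableSet {ω | X r ω < a + r * m} := fun r hr =>
    measurableSet_lt (hX.measurable r hr) measurable_const
  refine (ENNReal.tendsto_toReal (measure_ne_top _ _)).comp ?_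
  refine tendsto_measure_of_ae_tendsto_indicator_of_isFiniteMeasure atTop (hms t ht)
    (fun n => hms _ (hu n)) ?_
  filter_upwards [hX.continuous, measure_eq_zero_iff_ae_notMem.1 h0] with ω hc hne
  have hne' : X t ω ≠ a + t * m := hne
  have h1 : Tendsto (fun n => X (u n) ω) atTop (𝓝 (X t ω)) :=
    (hc t ht).tendsto.comp (tendsto_nhdsWithin_iff.2 ⟨hut, Eventually.of_forall hu⟩)
  have h2 : Tendsto (fun n => a + u n * m) atTop (𝓝 (a + t * m)) :=
    tendsto_const_nhds.add (hut.mul_const m)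
  rcases lt_or_gt_of_ne hne' with h | h
  · filter_upwards [h1.eventually_lt h2 h] with n hn
    exact ⟨fun _ => h, fun _ => hn⟩
  · filter_upwards [h2.eventually_lt h1 h] with n hn
    exact ⟨fun h' => absurd hn (not_lt.2 (le_of_lt h')),
      fun h' => absurd h (not_lt.2 (le_of_lt h'))⟩

/-- The mass to the left of a straight characteristic is conserved. -/
theorem measureReal_lt_characteristic_eq (hX : IsContinuousProcess μ X)
    (hV : IsTimeDerivative μ X V) (hv : IsConditionalVelocity μ X V v) {L a m : ℝ}
    (hL : ∀ t ∈ Icc (0 : ℝ) 1, ∀ x y : ℝ, |v t x - v t y| ≤ L * |x - y|)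
    (hm : ∀ t ∈ Icc (0 : ℝ) 1, v t (a + t * m) = m)
    (h0 : μ {ω | X 0 ω = a} = 0) (h1 : μ {ω | X 1 ω = a + m} = 0)
    {t : ℝ} (ht : t ∈ Icc (0 : ℝ) 1) :
    μ.real {ω | X t ω < a + t * m} = μ.real {ω | X 0 ω < a} := by
  have hmid : ∀ t ∈ Ioo (0 : ℝ) 1, μ.real {ω | X t ω < a + t * m} =
      μ.real {ω | X (1 / 2) ω < a + (1 / 2) * m} := by
    intro t ht
    rcases le_total t (1 / 2) with h | h
    · exact (measureReal_lt_characteristic_eq_of_pos hX hV hv hL hm ht.1 h (by norm_num)).symm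
    · exact measureReal_lt_characteristic_eq_of_pos hX hV hv hL hm (by norm_num) h ht.2
  have hlim : Tendsto (fun n : ℕ => 1 / ((n : ℝ) + 1)) atTop (𝓝 0) :=
    tendsto_one_div_add_atTop_nhds_zero_nat
  -- The index shift keeps the approximating times strictly below `1`.
  have hlim' : Tendsto (fun n : ℕ => 1 / ((n + 1 : ℕ) + 1 : ℝ)) atTop (𝓝 0) :=
    hlim.comp (tendsto_add_atTop_nat 1)
  have hin : ∀ n : ℕ, 1 / ((n + 1 : ℕ) + 1 : ℝ) ∈ Ioo (0 : ℝ) 1 := by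
    intro n
    have hn : (0 : ℝ) ≤ n := n.cast_nonneg
    refine ⟨by positivity, ?_⟩
    rw [div_lt_one (by positivity)]
    push_cast
    linarith
  have e0 : μ.real {ω | X 0 ω < a + 0 * m} =
      μ.real {ω | X (1 / 2) ω < a + (1 / 2) * m} := by
    refine tendsto_nhds_unique (hX.tendsto_measureReal_lt (by simp) (by simpa using h0)
      (fun n => Ioo_subset_Icc_self (hin n)) hlim') ?_
    exact tendsto_const_nhds.congr fun n => (hmid _ (hin n)).symm
  have e1 : μ.real {ω | X 1 ω < a + 1 * m} =
      μ.real {ω | X (1 / 2) ω < a + (1 / 2) * m} := by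
    have hin' : ∀ n : ℕ, 1 - 1 / ((n + 1 : ℕ) + 1 : ℝ) ∈ Ioo (0 : ℝ) 1 := fun n =>
      ⟨by linarith [(hin n).2], by linarith [(hin n).1]⟩
    refine tendsto_nhds_unique (hX.tendsto_measureReal_lt (by simp) (by simpa using h1)
      (fun n => Ioo_subset_Icc_self (hin' n)) (by simpa using hlim'.const_sub 1)) ?_
    exact tendsto_const_nhds.congr fun n => (hmid _ (hin' n)).symm
  have e : μ.real {ω | X t ω < a + t * m} = μ.real {ω | X (1 / 2) ω < a + (1 / 2) * m} := by
    rcases eq_or_lt_of_le ht.1 with h | h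
    · rw [← h]; exact e0
    · rcases eq_or_lt_of_le ht.2 with h' | h'
      · rw [h']; exact e1
      · exact hmid t ⟨h, h'⟩
  rw [e, ← e0, zero_mul, add_zero]

end Transport

/-! ### Straight flow lines and the crossing of a strip -/

/-- Without acceleration, the flow lines are straight and the velocity is constant along them. -/
theorem IsFlowMap.velocity_eq_of_hasNoAcceleration {v φ : ℝ → ℝ → ℝ} (hφ : IsFlowMap v φ)
    (hacc : HasNoAcceleration φ) (x : ℝ) {t : ℝ} (ht : t ∈ Icc (0 : ℝ) 1) :
    v t (x + t * v 0 x) = v 0 x := by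
  have hder : ∀ s ∈ Icc (0 : ℝ) 1,
      derivWithin (fun r => φ r x) (Icc 0 1) s = v s (φ s x) := fun s hs =>
    ((hφ x).2 s hs).derivWithin (uniqueDiffOn_Icc zero_lt_one s hs)
  have hconst : ∀ s ∈ Icc (0 : ℝ) 1, v s (φ s x) = v 0 x := by
    intro s hs
    have h1 := constant_of_derivWithin_zero (a := 0) (b := 1)
      (f := fun s => derivWithin (fun r => φ r x) (Icc 0 1) s)
      (fun s hs => (hacc x s hs).differentiableWithinAt)
      (fun s hs => (hacc x s (Ico_subset_Icc_self hs)).derivWithin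
        (uniqueDiffOn_Icc zero_lt_one s (Ico_subset_Icc_self hs))) s hs
    rw [hder s hs, hder 0 (by simp), (hφ x).1] at h1
    exact h1
  have hline : φ t x = x + t * v 0 x := by
    have h2 : ∀ s ∈ Icc (0 : ℝ) 1,
        HasDerivWithinAt (fun s => φ s x - s * v 0 x) 0 (Icc 0 1) s := by
      intro s hs
      have h3 := ((hφ x).2 s hs).sub ((hasDerivWithinAt_id s (Icc 0 1)).mul_const (v 0 x))
      rw [hconst s hs, one_mul, sub_self] at h3
      exact h3
    have h4 := constant_of_derivWithin_zero (a := 0) (b := 1)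
      (fun s hs => (h2 s hs).differentiableWithinAt)
      (fun s hs => (h2 s (Ico_subset_Icc_self hs)).derivWithin
        (uniqueDiffOn_Icc zero_lt_one s (Ico_subset_Icc_self hs))) t ht
    simp only [(hφ x).1, zero_mul, sub_zero] at h4
    linarith
  rw [← hline]
  exact hconst t ht

/-- A path that starts well to the left of the line from `a` to `l`, ends to its right, does not move
far at early times and has small increments, visits at some time of the grid the region between the
line from `a` to `l` and the line from `b` to `r`. -/
theorem exists_grid_mem_strip {f : ℝ → ℝ} {a b l r ρ θ θ' τ M : ℝ} {N : ℕ} (hN : 0 < N)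
    (hab : a ≤ b) (hlr : l ≤ r) (hM : |l - a| ≤ M) (hρ : θ + M * τ ≤ ρ)
    (hθ' : θ' + M * (1 / N) ≤ τ * (r - l))
    (hf0 : f 0 < a - ρ) (hf1 : l ≤ f 1)
    (hearly : ∀ t ∈ Icc (0 : ℝ) 1, t ≤ τ → |f t - f 0| < θ)
    (hinc : ∀ t ∈ Icc (0 : ℝ) 1, ∀ s ∈ Icc (0 : ℝ) 1, |t - s| ≤ 1 / N → |f t - f s| < θ') :
    ∃ k ≤ N, a + (k / N : ℝ) * (l - a) ≤ f (k / N) ∧ f (k / N) < b + (k / N : ℝ) * (r - b) := by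
  classical
  have hN' : (0 : ℝ) < N := by exact_mod_cast hN
  have hex : ∃ k : ℕ, a + (k / N : ℝ) * (l - a) ≤ f (k / N) :=
    ⟨N, by rw [div_self hN'.ne']; linarith⟩
  -- The first grid time at which the path has passed the left line; it remains to see that the path
  -- has not yet passed the right one.
  set k := Nat.find hex with hk
  have hkp : a + (k / N : ℝ) * (l - a) ≤ f (k / N) := Nat.find_spec hex
  have hkN : k ≤ N := Nat.find_min' hex (by rw [div_self hN'.ne']; linarith)
  have hgrid : ∀ j : ℕ, j ≤ N → (j / N : ℝ) ∈ Icc (0 : ℝ) 1 := fun j hj =>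
    ⟨by positivity, (div_le_one hN').2 (by exact_mod_cast hj)⟩
  have htk := hgrid k hkN
  have hM0 : 0 ≤ M := (abs_nonneg _).trans hM
  obtain ⟨hM1, hM2⟩ := abs_le.1 hM
  have hlate : τ < k / N := by
    by_contra! hle
    have h1 := abs_lt.1 (hearly _ htk hle)
    have h2 : (k / N : ℝ) * M ≤ M * τ := by
      rw [mul_comm]
      exact mul_le_mul_of_nonneg_left hle hM0
    have h3 : (k / N : ℝ) * (-M) ≤ (k / N : ℝ) * (l - a) :=
      mul_le_mul_of_nonneg_left hM1 htk.1
    linarith [h1.2]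
  refine ⟨k, hkN, hkp, ?_⟩
  -- No sign of `τ` is assumed: `k = 0` would make `τ` negative, against `hθ'`.
  have hk0 : k ≠ 0 := by
    intro h0
    have h2 : 0 ≤ M * (1 / (N : ℝ)) := by positivity
    rw [h0] at hkp hlate
    simp only [Nat.cast_zero, zero_div, zero_mul, add_zero] at hkp hlate
    have h3 : 0 < θ' := (abs_nonneg _).trans_lt (hinc 0 (by simp) 0 (by simp) (by simp))
    linarith [mul_nonpos_of_nonpos_of_nonneg hlate.le (sub_nonneg.2 hlr)]
  obtain ⟨j, hj⟩ := Nat.exists_eq_succ_of_ne_zero hk0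
  have hjp : f (j / N) < a + (j / N : ℝ) * (l - a) :=
    not_le.1 (Nat.find_min hex (by omega))
  have hjk : (k / N : ℝ) = j / N + 1 / N := by rw [hj]; push_cast; ring
  have hstep := abs_lt.1 (hinc _ htk _ (hgrid j (by omega))
    (by rw [hjk, add_sub_cancel_left, abs_of_pos (by positivity)]))
  have h4 : (1 / N : ℝ) * (-M) ≤ (1 / N : ℝ) * (l - a) :=
    mul_le_mul_of_nonneg_left hM1 (by positivity)
  have h5 : a + (j / N : ℝ) * (l - a) = a + (k / N : ℝ) * (l - a) - (1 / N : ℝ) * (l - a) := by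
    rw [hjk]; ring
  -- In one grid step the path gains less than `θ'` and the left line moves by at most `M / N`;
  -- together this is at most `τ * (r - l)`, a lower bound for the width of the strip at this time.
  have h6 : τ * (r - l) ≤ (k / N : ℝ) * (r - l) :=
    mul_le_mul_of_nonneg_right hlate.le (sub_nonneg.2 hlr)
  have h7 : 0 ≤ (1 - k / N : ℝ) * (b - a) :=
    mul_nonneg (sub_nonneg.2 htk.2) (sub_nonneg.2 hab)
  linarith [hstep.2]

/-! ### Concentration, independent endpoints and mass estimates -/

/-- Selects a time scale at which both the displacement of a line and the modulus probability are
small. All smaller scales are allowed, so that `1 / N` can be taken. -/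
theorem exists_forall_mul_rpow_le {A α M η σ : ℝ} (B : ℝ) (hα : 0 < α) (hη : 0 < η) (hσ : 0 < σ) :
    ∃ δ : ℝ, 0 < δ ∧ ∀ δ' : ℝ, 0 < δ' → δ' ≤ δ → M * δ' ≤ σ ∧ A * (δ' ^ α / B) ≤ η := by
  have h1 : Tendsto (fun δ : ℝ => M * δ) (𝓝 0) (𝓝 0) := by
    simpa using (continuous_const_mul M).tendsto 0
  have h2 : Tendsto (fun δ : ℝ => A * (δ ^ α / B)) (𝓝 0) (𝓝 0) := by
    have h3 := (((Real.continuousAt_rpow_const 0 α (Or.inr hα.le)).tendsto.div_const B).const_mul A)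
    simpa [Real.zero_rpow hα.ne'] using h3
  obtain ⟨e, he, h⟩ := Metric.eventually_nhds_iff.1
    ((h1.eventually (Iio_mem_nhds hσ)).and (h2.eventually (Iio_mem_nhds hη)))
  refine ⟨e / 2, half_pos he, fun δ' h0 hle => ?_⟩
  have := h (y := δ') (by rw [Real.dist_eq, sub_zero, abs_of_pos h0]; linarith)
  exact ⟨le_of_lt this.1, le_of_lt this.2⟩

theorem abs_sub_lt_of_pathModulus_lt {Ω : Type u} {X : ℝ → Ω → ℝ} {δ θ : ℝ} {ω : Ω}
    (h : ω ∉ {ω | ENNReal.ofReal θ ≤ pathModulus X δ ω}) {t s : ℝ} (ht : t ∈ Icc (0 : ℝ) 1)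
    (hs : s ∈ Icc (0 : ℝ) 1) (hts : |t - s| ≤ δ) : |X t ω - X s ω| < θ := by
  have h1 : pathModulus X δ ω < ENNReal.ofReal θ := not_le.1 h
  have h2 : ENNReal.ofReal |X t ω - X s ω| ≤ pathModulus X δ ω :=
    le_iSup₂_of_le t ht (le_iSup₂_of_le s hs (le_iSup_of_le hts le_rfl))
  exact (ENNReal.ofReal_lt_ofReal_iff_of_nonneg (abs_nonneg _)).1 (h2.trans_lt h1)

section Processes

variable {Ω : Type u} [MeasurableSpace Ω] {μ : Measure Ω}
  {X : ℝ → Ω → ℝ}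

theorem measureReal_pathModulus_le {A α β : ℝ} (hX : X ∈ concentrationClass μ A α β) {θ δ η : ℝ}
    (hη : 0 ≤ η) (hθ : 0 < θ) (hδ : 0 < δ) (h : A * (δ ^ α / θ ^ β) ≤ η) :
    μ.real {ω | ENNReal.ofReal θ ≤ pathModulus X δ ω} ≤ η :=
  ENNReal.toReal_le_of_le_ofReal hη ((hX.2 θ δ hθ hδ).trans (ENNReal.ofReal_le_ofReal h))

variable [IsProbabilityMeasure μ] {P₀ P₁ : Measure ℝ} [IsProbabilityMeasure P₀]
  [IsProbabilityMeasure P₁]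

/-- A straight-line process transports `P₀` along straight lines `x ↦ x + t u(x)`, with `u`
continuous, that separate the mass in a constant proportion. -/
theorem exists_lines_of_mem_straightLineProcesses (h₀ : P₀ ≪ volume) (h₁ : P₁ ≪ volume)
    (hX : X ∈ straightLineProcesses μ P₀ P₁) :
    ∃ u : ℝ → ℝ, Continuous u ∧ ∀ x, ∀ t ∈ Icc (0 : ℝ) 1,
      μ.real {ω | X t ω < x + t * u x} = P₀.real (Iio x) := by
  obtain ⟨⟨hc, hlaw⟩, V, v, φ, hV, hv, ⟨L, -, hL⟩, hφ, hacc⟩ := hX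
  have hX0 := hc.measurable 0 (by simp)
  have hX1 := hc.measurable 1 (by simp)
  have hl0 : μ.map (X 0) = P₀ := by
    rw [← Measure.fst_map_prodMk hX1, hlaw, Measure.fst_prod]
  have hl1 : μ.map (X 1) = P₁ := by
    rw [← Measure.snd_map_prodMk hX0, hlaw, Measure.snd_prod]
  have hz0 : ∀ x, μ {ω | X 0 ω = x} = 0 := fun x => by
    have := h₀ (Real.volume_singleton (a := x))
    rwa [← hl0, Measure.map_apply hX0 (measurableSet_singleton x)] at this
  have hz1 : ∀ x, μ {ω | X 1 ω = x} = 0 := fun x => by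
    have := h₁ (Real.volume_singleton (a := x))
    rwa [← hl1, Measure.map_apply hX1 (measurableSet_singleton x)] at this
  refine ⟨v 0, ?_, fun x t ht => ?_⟩
  · refine (LipschitzWith.of_dist_le' (K := L) fun x y => ?_).continuous
    exact hL 0 (by simp) x y
  · rw [measureReal_lt_characteristic_eq hc hV hv hL
      (fun t ht => hφ.velocity_eq_of_hasNoAcceleration hacc x ht) (hz0 x) (hz1 _) ht, ← hl0,
      map_measureReal_apply hX0 measurableSet_Iio]
    rfl

/-- By the intermediate value theorem: if `T` stayed on one side of `y`, the distribution function
of `P₀` could not tend to both `0` and `1`. -/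
theorem exists_eq_of_measureReal_Iio_eq {T : ℝ → ℝ} (hT : Continuous T)
    (h : ∀ x, P₁.real (Iio (T x)) = P₀.real (Iio x)) {y : ℝ} (hy0 : 0 < P₁.real (Iio y))
    (hy1 : P₁.real (Iio y) < 1) : ∃ x, T x = y := by
  have hlow : ∃ x, T x ≤ y := by
    by_contra! hlow
    obtain ⟨x, hx⟩ := ((tendsto_cdf_atBot P₀).eventually (Iio_mem_nhds hy0)).exists
    rw [cdf_eq_real] at hx
    have h1 : P₁.real (Iio y) ≤ P₁.real (Iio (T x)) :=
      measureReal_mono (Iio_subset_Iio (hlow x).le)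
    have h2 : P₀.real (Iio x) ≤ P₀.real (Iic x) := measureReal_mono Iio_subset_Iic_self
    linarith [h x]
  have hhigh : ∃ x, y ≤ T x := by
    by_contra! hhigh
    obtain ⟨x, hx⟩ := ((tendsto_cdf_atTop P₀).eventually (Ioi_mem_nhds hy1)).exists
    rw [cdf_eq_real] at hx
    have h1 : P₁.real (Iio (T (x + 1))) ≤ P₁.real (Iio y) :=
      measureReal_mono (Iio_subset_Iio (hhigh _).le)
    have h2 : P₀.real (Iic x) ≤ P₀.real (Iio (x + 1)) :=
      measureReal_mono (Iic_subset_Iio.2 (by linarith))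
    linarith [h (x + 1)]
  obtain ⟨x₁, h1⟩ := hlow
  obtain ⟨x₂, h2⟩ := hhigh
  exact mem_range_of_exists_le_of_exists_ge hT ⟨x₁, h1⟩ ⟨x₂, h2⟩

omit [IsProbabilityMeasure μ] [IsProbabilityMeasure P₀] in
theorem measureReal_mem_and_mem_eq (hX : X ∈ independentEndpointProcesses μ P₀ P₁) {s t : Set ℝ}
    (hs : MeasurableSet s) (ht : MeasurableSet t) :
    μ.real {ω | X 0 ω ∈ s ∧ X 1 ω ∈ t} = P₀.real s * P₁.real t := by
  rw [← measureReal_prod_prod, ← hX.2, map_measureReal_apply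
    ((hX.1.measurable 0 (by simp)).prodMk (hX.1.measurable 1 (by simp))) (hs.prod ht)]
  rfl

omit [IsProbabilityMeasure μ] [IsProbabilityMeasure P₀] in
theorem measureReal_zero_mem_eq (hX : X ∈ independentEndpointProcesses μ P₀ P₁) {s : Set ℝ}
    (hs : MeasurableSet s) : μ.real {ω | X 0 ω ∈ s} = P₀.real s := by
  simpa using measureReal_mem_and_mem_eq hX hs MeasurableSet.univ

omit [IsProbabilityMeasure μ] in
theorem measureReal_one_mem_eq (hX : X ∈ independentEndpointProcesses μ P₀ P₁) {s : Set ℝ}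
    (hs : MeasurableSet s) : μ.real {ω | X 1 ω ∈ s} = P₁.real s := by
  simpa using measureReal_mem_and_mem_eq hX MeasurableSet.univ hs

/-- Tightness of the initial law, from the final law and the modulus of continuity. -/
theorem measureReal_le_abs_le (hX : X ∈ independentEndpointProcesses μ P₀ P₁) (R K : ℝ) :
    P₀.real {x | R + K ≤ |x|} ≤
      P₁.real {x | R < |x|} + μ.real {ω | ENNReal.ofReal K ≤ pathModulus X 1 ω} := by
  have hsub : {ω | X 0 ω ∈ {x : ℝ | R + K ≤ |x|}} ⊆ {ω | X 1 ω ∈ {x : ℝ | R < |x|}} ∪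
      {ω | ENNReal.ofReal K ≤ pathModulus X 1 ω} := by
    intro ω hω
    by_contra hnot
    rw [mem_union, not_or] at hnot
    have h1 := abs_sub_lt_of_pathModulus_lt hnot.2 (t := 0) (s := 1) (by simp) (by simp)
      (by simp)
    have h2 : |X 1 ω| ≤ R := not_lt.1 hnot.1
    have h3 : R + K ≤ |X 0 ω| := hω
    linarith [abs_sub_abs_le_abs_sub (X 0 ω) (X 1 ω)]
  have hm1 : MeasurableSet {x : ℝ | R + K ≤ |x|} :=
    measurableSet_le measurable_const measurable_norm
  have hm2 : MeasurableSet {x : ℝ | R < |x|} := measurableSet_lt measurable_const measurable_norm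
  rw [← measureReal_zero_mem_eq hX hm1, ← measureReal_one_mem_eq hX hm2]
  exact (measureReal_mono hsub).trans (measureReal_union_le _ _)

theorem measureReal_Iio_add_Ico (P : Measure ℝ) [IsFiniteMeasure P] {l r : ℝ} (h : l ≤ r) :
    P.real (Iio l) + P.real (Ico l r) = P.real (Iio r) := by
  rw [← Iio_union_Ico_eq_Iio h, measureReal_union ?_ measurableSet_Ico]
  exact disjoint_left.2 fun x hx hx' => not_lt.2 hx'.1 hx

theorem measureReal_Iio_add_Ici (P : Measure ℝ) [IsProbabilityMeasure P] (y : ℝ) :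
    P.real (Iio y) + P.real (Ici y) = 1 := by
  rw [← compl_Iio, probReal_add_probReal_compl measurableSet_Iio]

/-- If a straight-line process leaves mass at least `w` to the left of `l` and to the right of `r`
at time `1`, there are straight lines that end at `l` and at `r`, and the mass between these lines
is at all times the mass of the final law between `l` and `r`. -/
theorem exists_strip_of_mem_straightLineProcesses (h₀ : IsPositiveAC P₀) (h₁ : P₁ ≪ volume)
    (hX : X ∈ straightLineProcesses μ P₀ P₁) {l r : ℝ} (hlr : l < r)
    (hl : 0 < P₁.real (Iio l)) (hr : 0 < P₁.real (Ici r)) :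
    ∃ a b : ℝ, a ≤ b ∧ P₀.real (Iio a) = P₁.real (Iio l) ∧ ∀ t ∈ Icc (0 : ℝ) 1,
      μ.real {ω | a + t * (l - a) ≤ X t ω ∧ X t ω < b + t * (r - b)} = P₁.real (Ico l r) := by
  obtain ⟨u, hu, hline⟩ := exists_lines_of_mem_straightLineProcesses h₀.1 h₁ hX
  have hT : ∀ x, P₁.real (Iio (x + u x)) = P₀.real (Iio x) := fun x => by
    rw [← hline x 1 (by simp), one_mul, ← measureReal_one_mem_eq hX.1 measurableSet_Iio]
    rfl
  have hlr1 := measureReal_Iio_add_Ico P₁ hlr.le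
  have hTc : Continuous fun x => x + u x := continuous_id.add hu
  have hgap : 0 ≤ P₁.real (Ico l r) := measureReal_nonneg
  have hr1 := measureReal_Iio_add_Ici P₁ r
  obtain ⟨a, ha⟩ := exists_eq_of_measureReal_Iio_eq hTc hT (y := l) hl (by linarith)
  obtain ⟨b, hb⟩ := exists_eq_of_measureReal_Iio_eq hTc hT (y := r) (by linarith) (by linarith)
  have hPa : P₀.real (Iio a) = P₁.real (Iio l) := by rw [← hT, ha]
  have hPb : P₀.real (Iio b) = P₁.real (Iio r) := by rw [← hT, hb]
  have hab : a ≤ b := by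
    by_contra! hba
    -- Positivity of `P₀` makes its quantiles strictly ordered, so the lines start in the same order
    -- as they end.
    have h1 : 0 < P₀ (Ico b a) := h₀.2 _ measurableSet_Ico (by simpa using hba)
    have h3 : 0 < P₀.real (Ico b a) := ENNReal.toReal_pos h1.ne' (measure_ne_top _ _)
    linarith [measureReal_Iio_add_Ico P₀ hba.le]
  refine ⟨a, b, hab, hPa, fun t ht => ?_⟩
  have hXt := hX.1.1.measurable t ht
  have h1 := hline a t ht
  have h2 := hline b t ht
  rw [show u a = l - a by linarith] at h1
  rw [show u b = r - b by linarith] at h2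
  have h3 : {ω | X t ω < b + t * (r - b)} = {ω | X t ω < a + t * (l - a)} ∪
      {ω | a + t * (l - a) ≤ X t ω ∧ X t ω < b + t * (r - b)} := by
    ext ω
    have h4 : a + t * (l - a) ≤ b + t * (r - b) := by
      linarith [mul_nonneg (sub_nonneg.2 ht.2) (sub_nonneg.2 hab),
        mul_nonneg ht.1 (sub_nonneg.2 hlr.le)]
    simp only [mem_union, mem_ofPred_eq]
    constructor
    · intro h
      rcases lt_or_ge (X t ω) (a + t * (l - a)) with h' | h'
      · exact Or.inl h'
      · exact Or.inr ⟨h', h⟩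
    · rintro (h | h)
      · exact h.trans_le h4
      · exact h.2
  have hms : MeasurableSet {ω | a + t * (l - a) ≤ X t ω ∧ X t ω < b + t * (r - b)} :=
    (measurableSet_le measurable_const hXt).inter (measurableSet_lt hXt measurable_const)
  rw [h3, measureReal_union ?_ hms] at h2
  · linarith
  · exact disjoint_left.2 fun ω h h' => not_lt.2 h'.1 h

/-- The paths from the far left of `a` to the right of `l` are rare if the strip between the lines
from `a` to `l` and from `b` to `r` has little mass, unless they move fast. -/
theorem measureReal_crossing_le {a b l r ρ θ θ' τ M η : ℝ} {N : ℕ} (hN : 0 < N)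
    (hab : a ≤ b) (hlr : l ≤ r) (hM : |l - a| ≤ M) (hρ : θ + M * τ ≤ ρ)
    (hθ' : θ' + M * (1 / N) ≤ τ * (r - l))
    (hstrip : ∀ t ∈ Icc (0 : ℝ) 1,
      μ.real {ω | a + t * (l - a) ≤ X t ω ∧ X t ω < b + t * (r - b)} ≤ η) :
    μ.real {ω | X 0 ω ∈ Iio (a - ρ) ∧ X 1 ω ∈ Ici r} ≤
      μ.real {ω | ENNReal.ofReal θ ≤ pathModulus X τ ω} +
        μ.real {ω | ENNReal.ofReal θ' ≤ pathModulus X (1 / N) ω} + (N + 1) * η := by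
  have hN0 : (0 : ℝ) < N := by exact_mod_cast hN
  have hcross : {ω | X 0 ω ∈ Iio (a - ρ) ∧ X 1 ω ∈ Ici r} ⊆
      ({ω | ENNReal.ofReal θ ≤ pathModulus X τ ω} ∪
        {ω | ENNReal.ofReal θ' ≤ pathModulus X (1 / N) ω}) ∪
      ⋃ k ∈ Finset.range (N + 1), {ω | a + (k / N : ℝ) * (l - a) ≤ X (k / N) ω ∧
        X (k / N) ω < b + (k / N : ℝ) * (r - b)} := by
    rintro ω ⟨hω0, hω1⟩
    by_contra hnot
    rw [mem_union, not_or, mem_union, not_or] at hnot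
    obtain ⟨⟨hb1, hb2⟩, hb3⟩ := hnot
    obtain ⟨k, hk, hk'⟩ := exists_grid_mem_strip (f := fun t => X t ω) hN hab hlr hM hρ hθ' hω0
      (hlr.trans hω1)
      (fun t ht htτ => abs_sub_lt_of_pathModulus_lt hb1 ht (by simp)
        (by rwa [sub_zero, abs_of_nonneg ht.1]))
      (fun t ht s hs hts => abs_sub_lt_of_pathModulus_lt hb2 ht hs hts)
    exact hb3 (mem_biUnion (Finset.mem_coe.2 (Finset.mem_range.2 (by omega))) hk')
  refine (measureReal_mono hcross).trans ((measureReal_union_le _ _).trans (add_le_add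
    (measureReal_union_le _ _) ?_))
  refine (measureReal_biUnion_finset_le _ _).trans ((Finset.sum_le_card_nsmul _ _
    η fun k hk => hstrip _ ⟨by positivity, ?_⟩).trans_eq ?_)
  · rw [div_le_one hN0]
    exact_mod_cast Nat.lt_succ_iff.1 (Finset.mem_range.1 hk)
  · rw [Finset.card_range, nsmul_eq_mul]
    push_cast
    ring

end Processes

/-! ### Choice of constants and the contradiction -/

/-- Straight-line processes of a given concentration class cannot connect `P₀` to a measure `P₁`
with almost no mass between `l` and `r`, but with a given amount of mass on either side. -/
theorem exists_eps_forall_gap {C γ l r R w A α β : ℝ} (hγ : 0 < γ) (hlr : l < r)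
    (hR : 0 ≤ R) (hw : 0 < w) (hA : 0 < A) (hα : 0 < α) (hβ : 0 < β) :
    ∃ ε₀ : ℝ, 0 < ε₀ ∧
      ∀ (P₀ P₁ : Measure ℝ) [IsProbabilityMeasure P₀] [IsProbabilityMeasure P₁],
        IsPositiveAC P₀ → IsFrostman P₀ C γ → P₁ ≪ volume →
        w ≤ P₁.real (Iio l) → w ≤ P₁.real (Ici r) →
        P₁.real (Ico l r) ≤ ε₀ → P₁.real {x | R < |x|} ≤ ε₀ →
        ∀ (Ω : Type u) [MeasurableSpace Ω] (μ : Measure Ω) [IsProbabilityMeasure μ],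
          straightLineProcesses μ P₀ P₁ ∩ concentrationClass μ A α β = ∅ := by
  obtain ⟨ρ, hρ, hCρ⟩ : ∃ ρ : ℝ, 0 < ρ ∧ C * (2 * ρ) ^ γ ≤ w / 2 := by
    obtain ⟨δ, hδ, h⟩ := exists_forall_mul_rpow_le (A := C) (M := 0) 1 hγ (half_pos hw) one_pos
    refine ⟨δ / 2, half_pos hδ, ?_⟩
    have := (h δ hδ le_rfl).2
    rwa [div_one, ← mul_div_cancel₀ δ (two_ne_zero' ℝ)] at this
  obtain ⟨K, hK, hAK⟩ : ∃ K : ℝ, 0 < K ∧ A * ((1 : ℝ) ^ α / K ^ β) ≤ w / 4 := by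
    -- Solves `A / K ^ β = w / 4`.
    refine ⟨(4 * A / w) ^ β⁻¹, by positivity, ?_⟩
    rw [Real.rpow_inv_rpow (by positivity) hβ.ne', Real.one_rpow]
    apply le_of_eq
    field_simp
  set M := |l| + (R + K) with hM
  have hM0 : 0 < M := by positivity
  obtain ⟨τ, hτ, hτ'⟩ := exists_forall_mul_rpow_le (A := A) (M := M) ((ρ / 2) ^ β) hα
    (show 0 < w ^ 2 / 8 by positivity) (half_pos hρ)
  obtain ⟨hMτ, hAτ⟩ := hτ' τ hτ le_rfl
  -- Half of the width bound at time `τ`; the other half is left for the motion `M / N` of the line.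
  set θ' := τ * (r - l) / 2 with hθ'
  have hθ'0 : 0 < θ' := half_pos (mul_pos hτ (sub_pos.2 hlr))
  obtain ⟨δ, hδ, hδ'⟩ := exists_forall_mul_rpow_le (A := A) (M := M) (θ' ^ β) hα
    (show 0 < w ^ 2 / 8 by positivity) hθ'0
  obtain ⟨n, hn⟩ := exists_nat_one_div_lt hδ
  set N := n + 1 with hN
  have hN0 : (0 : ℝ) < N := by positivity
  obtain ⟨hMN, hAN⟩ := hδ' (1 / N) (by positivity) (by rw [hN]; push_cast; exact hn.le)
  -- The first bound serves the tightness of `P₀`; the second makes the `N + 1` grid strips weigh at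
  -- most `w ^ 2 / 8` in total.
  refine ⟨min (w / 4) (w ^ 2 / 8 / (N + 1)), by positivity, ?_⟩
  intro P₀ P₁ _ _ hP₀ hF hP₁ hwl hwr hgap htail Ω _ μ _
  rw [eq_empty_iff_forall_notMem]
  rintro X ⟨hX, hconc⟩
  have hgap0 : 0 ≤ P₁.real (Ico l r) := measureReal_nonneg
  obtain ⟨a, b, hab, hPa, hstrip⟩ := exists_strip_of_mem_straightLineProcesses hP₀ hP₁ hX hlr
    (hw.trans_le hwl) (hw.trans_le hwr)
  have htight : P₀.real {x | R + K ≤ |x|} ≤ w / 2 := by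
    have h1 := measureReal_le_abs_le hX.1 R K
    have h2 := measureReal_pathModulus_le hconc (by positivity : 0 ≤ w / 4) hK one_pos hAK
    linarith [htail.trans (min_le_left _ _)]
  -- Both sides of `a` have `P₀`-mass at least `w`, while the tail beyond `R + K` has at most `w /
  -- 2`.
  have haK : |a| ≤ R + K := by
    by_contra! hlt
    rcases le_total 0 a with h0 | h0
    · rw [abs_of_nonneg h0] at hlt
      have h1 : P₀.real (Ici a) ≤ P₀.real {x | R + K ≤ |x|} :=
        measureReal_mono fun x hx => (hlt.le.trans hx).trans (le_abs_self x)
      linarith [measureReal_Iio_add_Ici P₀ a, measureReal_Iio_add_Ici P₁ r,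
        measureReal_Iio_add_Ico P₁ hlr.le]
    · rw [abs_of_nonpos h0] at hlt
      have h1 : P₀.real (Iio a) ≤ P₀.real {x | R + K ≤ |x|} :=
        measureReal_mono fun x hx => by
          have hx' : x < a := hx
          exact (show R + K ≤ -x by linarith).trans (neg_le_abs x)
      linarith
  have hMa : |l - a| ≤ M := (abs_sub _ _).trans (by rw [hM]; gcongr)
  have hcross := measureReal_crossing_le (μ := μ) (X := X) (Nat.succ_pos n) hab hlr.le hMa
    (show ρ / 2 + M * τ ≤ ρ by linarith) (show θ' + M * (1 / N) ≤ τ * (r - l) by linarith)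
    fun t ht => (hstrip t ht).le.trans (hgap.trans (min_le_right _ _))
  have hfast := measureReal_pathModulus_le hconc (by positivity) (half_pos hρ) hτ hAτ
  have hfast' := measureReal_pathModulus_le hconc (by positivity) hθ'0 (by positivity) hAN
  have hη : ((N : ℝ) + 1) * (w ^ 2 / 8 / (N + 1)) = w ^ 2 / 8 :=
    mul_div_cancel₀ _ (by positivity)
  have hlower : w / 2 ≤ P₀.real (Iio (a - ρ)) := by
    have h1 : P₀.real (Metric.ball a (2 * ρ)) ≤ w / 2 :=
      ENNReal.toReal_le_of_le_ofReal (half_pos hw).le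
        ((hF a (2 * ρ) (by positivity)).trans (ENNReal.ofReal_le_ofReal hCρ))
    have h2 : Iio a ⊆ Iio (a - ρ) ∪ Metric.ball a (2 * ρ) := by
      intro x hx
      have hx' : x < a := hx
      rcases lt_or_ge x (a - ρ) with h | h
      · exact Or.inl h
      · refine Or.inr ?_
        rw [Metric.mem_ball, Real.dist_eq, abs_lt]
        constructor <;> linarith
    have h3 := (measureReal_mono h2 (μ := P₀)).trans (measureReal_union_le _ _)
    linarith
  rw [measureReal_mem_and_mem_eq hX.1 measurableSet_Iio measurableSet_Ici] at hcross
  have h1 : w / 2 * w ≤ P₀.real (Iio (a - ρ)) * P₁.real (Ici r) :=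
    mul_le_mul hlower hwr hw.le measureReal_nonneg
  have h2 : 0 < w * w := mul_pos hw hw
  -- Crossings have probability at least `w ^ 2 / 2`, but at most three times `w ^ 2 / 8`.
  nlinarith

/-! ### Separation of the supports and the theorem -/

/-- Bounded sets with disjoint closed convex hulls are separated by a gap. -/
theorem exists_gap_of_disjoint_closedConvexHull {S₀ S₁ : Set ℝ} (h₀ : Bornology.IsBounded S₀)
    (hn₀ : S₀.Nonempty) (hn₁ : S₁.Nonempty)
    (h : closedConvexHull ℝ S₀ ∩ closedConvexHull ℝ S₁ = ∅) :
    ∃ l r : ℝ, l < r ∧ (S₀ ⊆ Iio l ∧ S₁ ⊆ Ioi r ∨ S₁ ⊆ Iio l ∧ S₀ ⊆ Ioi r) := by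
  have hcomp : IsCompact (closedConvexHull ℝ S₀) := by
    rw [closedConvexHull_eq_closure_convexHull]
    exact (isBounded_convexHull.2 h₀).isCompact_closure
  obtain ⟨f, p, q, hp, hpq, hq⟩ := geometric_hahn_banach_compact_closed convex_closedConvexHull
    hcomp convex_closedConvexHull isClosed_closedConvexHull (disjoint_iff_inter_eq_empty.2 h)
  have hf : ∀ x, f x = x * f 1 := fun x => by
    rw [← smul_eq_mul, ← map_smul, smul_eq_mul, mul_one]
  have hp' : ∀ x ∈ S₀, x * f 1 < p := fun x hx => by
    rw [← hf]; exact hp x (subset_closedConvexHull hx)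
  have hq' : ∀ x ∈ S₁, q < x * f 1 := fun x hx => by
    rw [← hf]; exact hq x (subset_closedConvexHull hx)
  rcases lt_trichotomy (f 1) 0 with h1 | h1 | h1
  · exact ⟨q / f 1, p / f 1, (div_lt_div_right_of_neg h1).2 hpq,
      Or.inr ⟨fun x hx => (lt_div_iff_of_neg h1).2 (hq' x hx),
        fun x hx => (div_lt_iff_of_neg h1).2 (hp' x hx)⟩⟩
  · obtain ⟨x, hx⟩ := hn₀
    obtain ⟨y, hy⟩ := hn₁
    have h2 := hp' x hx
    have h3 := hq' y hy
    rw [h1, mul_zero] at h2 h3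
    linarith
  · exact ⟨p / f 1, q / f 1, (div_lt_div_iff_of_pos_right h1).2 hpq,
      Or.inl ⟨fun x hx => (lt_div_iff₀ h1).2 (hp' x hx),
        fun x hx => (div_lt_iff₀ h1).2 (hq' x hx)⟩⟩

/-- The mass missed by disjoint open sets bounds that of any set outside of them. -/
theorem measureReal_le_of_disjoint_union {P : Measure ℝ} [IsProbabilityMeasure P] {ε : ℝ}
    {S₀ S₁ T : Set ℝ} (h₁ : MeasurableSet S₁) (h₀ : MeasurableSet S₀) (hd : Disjoint S₀ S₁)
    (hmass : 1 - ε ≤ P.real S₀ + P.real S₁) (h : T ⊆ (S₀ ∪ S₁)ᶜ) : P.real T ≤ ε := by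
  have h2 := measureReal_mono h (μ := P)
  rw [probReal_compl_eq_one_sub (h₀.union h₁), measureReal_union hd h₁] at h2
  linarith

theorem mainTheorem1
    (C γ : ℝ) (hC : 0 < C) (hγ : 0 < γ)
    (S₀ S₁ : Set ℝ)
    (w₀ w₁ : ℝ) (hw₀ : 0 < w₀) (hw₁ : 0 < w₁)
    (A α β : ℝ) (hA : 0 < A) (hα : 0 < α) (hβ : 0 < β) :
    ∃ ε₀ : ℝ, 0 < ε₀ ∧
      ∀ (P₀ P₁ : Measure ℝ) [IsProbabilityMeasure P₀] [IsProbabilityMeasure P₁] (ε : ℝ),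
        IsPositiveAC P₀ → IsFrostman P₀ C γ →
        P₁ ≪ volume →
        0 < ε → HasProperlyDisconnectedSupportOn P₁ ε S₀ S₁ →
        w₀ ≤ P₁.real S₀ → w₁ ≤ P₁.real S₁ →
        ε ≤ ε₀ →
        ∀ (Ω : Type u) [MeasurableSpace Ω] (μ : Measure Ω) [IsProbabilityMeasure μ],
          straightLineProcesses μ P₀ P₁ ∩ concentrationClass μ A α β = ∅ := by
  by_cases hS : Bornology.IsBounded S₀ ∧ Bornology.IsBounded S₁ ∧ S₀.Nonempty ∧ S₁.Nonempty ∧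
      closedConvexHull ℝ S₀ ∩ closedConvexHull ℝ S₁ = ∅
  swap
  -- For inadmissible sets no `P₁` satisfies the hypotheses, so any threshold works.
  · refine ⟨1, one_pos, fun P₀ P₁ _ _ ε _ _ _ _ hd _ _ _ => absurd ?_ hS⟩
    exact ⟨hd.isBounded₀, hd.isBounded₁, nonempty_of_measure_ne_zero hd.pos₀.ne',
      nonempty_of_measure_ne_zero hd.pos₁.ne', hd.hulls⟩
  obtain ⟨hb₀, hb₁, hn₀, hn₁, hhull⟩ := hS
  obtain ⟨l, r, hlr, hsep⟩ := exists_gap_of_disjoint_closedConvexHull hb₀ hn₀ hn₁ hhull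
  obtain ⟨R, hR0, hR⟩ := (hb₀.union hb₁).exists_pos_norm_le
  obtain ⟨ε₀, hε₀, H⟩ := exists_eps_forall_gap (A := A) (α := α) (β := β) hγ hlr hR0.le
    (lt_min hw₀ hw₁) hA hα hβ
  refine ⟨ε₀, hε₀, fun P₀ P₁ _ _ ε hP₀ hF hP₁ _ hd hwS₀ hwS₁ hε => ?_⟩
  have hdisj : Disjoint S₀ S₁ := by
    refine disjoint_iff_inter_eq_empty.2 (subset_empty_iff.1 ?_)
    rw [← hhull]
    exact inter_subset_inter subset_closedConvexHull subset_closedConvexHull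
  have hout : ∀ T : Set ℝ, T ⊆ (S₀ ∪ S₁)ᶜ → P₁.real T ≤ ε₀ := fun T hT =>
    (measureReal_le_of_disjoint_union hd.isOpen₁.measurableSet hd.isOpen₀.measurableSet hdisj
      hd.mass hT).trans hε
  have htail : P₁.real {x | R < |x|} ≤ ε₀ := hout _ fun x hx hx' => not_lt.2 (hR x hx') hx
  have hgap : P₁.real (Ico l r) ≤ ε₀ := by
    refine hout _ fun x hx hx' => ?_
    rcases hsep with ⟨hl, hr⟩ | ⟨hl, hr⟩ <;> rcases hx' with h | h
    · exact not_lt.2 hx.1 (hl h)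
    · exact lt_asymm hx.2 (hr h)
    · exact lt_asymm hx.2 (hr h)
    · exact not_lt.2 hx.1 (hl h)
  rcases hsep with ⟨hl, hr⟩ | ⟨hl, hr⟩
  · exact H P₀ P₁ hP₀ hF hP₁ (((min_le_left _ _).trans hwS₀).trans (measureReal_mono hl))
      (((min_le_right _ _).trans hwS₁).trans
        (measureReal_mono (hr.trans Ioi_subset_Ici_self))) hgap htail
  · exact H P₀ P₁ hP₀ hF hP₁ (((min_le_right _ _).trans hwS₁).trans (measureReal_mono hl))
      (((min_le_left _ _).trans hwS₀).trans
        (measureReal_mono (hr.trans Ioi_subset_Ici_self))) hgap htail
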